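/- For a finite simple graph $G$ let $\gamma(G)$ be the minimum cardinality of a dominating set (a vertex set $S$ such that every vertex not in $S$ has a neighbour in $S$), let $\gamma_t(G)$ be the minimum cardinality of a total dominating set (a vertex set $S$ such that every vertex of $G$ has a neighbour in $S$), and let $\gamma_c(G)$ be the minimum cardinality of a connected dominating set (a dominating set that induces a connected subgraph). Let $P_n$ be the path on $n$ vertices and $\Box$ the Cartesian product of graphs. **Proposition.** Let $G$ be one of the grid graphs (a) $P_3\Box P_n$ with $n\ge 3$, or (b) $P_4\Box P_n$ with $n\ge 4$. Then $G$ is connected and has no isolated vertices, and $$\gamma_t(G)\ \ge\ \left\lceil \frac{3\gamma(G)+2\gamma_c(G)}{6}\right\rceil .$$ -/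

import Mathlib

open SimpleGraph

namespace SimpleGraph

variable {V : Type*}

/-- `S` is a dominating set: every vertex outside `S` has a neighbour in `S`. -/
def IsDominatingSet (G : SimpleGraph V) (S : Finset V) : Prop :=
  ∀ v, v ∉ S → ∃ u ∈ S, G.Adj v u

/-- `S` is a total dominating set: every vertex (in `S` or not) has a neighbour in `S`. -/
def IsTotalDominatingSet (G : SimpleGraph V) (S : Finset V) : Prop :=
  ∀ v, ∃ u ∈ S, G.Adj v u

/-- `S` is a connected dominating set: it is dominating and induces a connected subgraph. -/
def IsConnectedDominatingSet (G : SimpleGraph V) (S : Finset V) : Prop :=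
  G.IsDominatingSet S ∧ (G.induce (S : Set V)).Connected

/-- The domination number of a finite graph. -/
noncomputable def dominationNumber (G : SimpleGraph V) : ℕ :=
  sInf {k | ∃ S : Finset V, G.IsDominatingSet S ∧ S.card = k}

/-- The total domination number of a finite graph. The set below is nonempty exactly when the
finite graph `G` has no isolated vertices (see `exists_isTotalDominatingSet`). -/
noncomputable def totalDominationNumber (G : SimpleGraph V) : ℕ :=
  sInf {k | ∃ S : Finset V, G.IsTotalDominatingSet S ∧ S.card = k}

/-- The connected domination number of a finite graph. The set below is nonempty exactly when the
finite graph `G` is connected (see `exists_isConnectedDominatingSet`). -/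
noncomputable def connectedDominationNumber (G : SimpleGraph V) : ℕ :=
  sInf {k | ∃ S : Finset V, G.IsConnectedDominatingSet S ∧ S.card = k}

/-- A finite graph without isolated vertices has a total dominating set. -/
theorem exists_isTotalDominatingSet [Fintype V] (G : SimpleGraph V)
    (h : ∀ v, ∃ w, G.Adj v w) : ∃ S : Finset V, G.IsTotalDominatingSet S :=
  ⟨Finset.univ, fun v => (h v).imp fun _ hw => ⟨Finset.mem_univ _, hw⟩⟩

/-- A finite connected graph has a connected dominating set. -/
theorem exists_isConnectedDominatingSet [Fintype V] (G : SimpleGraph V)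
    (h : G.Connected) : ∃ S : Finset V, G.IsConnectedDominatingSet S := by
  refine ⟨Finset.univ, fun v hv => absurd (Finset.mem_univ v) hv, ?_⟩
  rw [Finset.coe_univ]
  exact (induceUnivIso G).connected_iff.mpr h

end SimpleGraph

/-!
A total dominating set is dominating, so `γ ≤ γ_t`, and the inequality `3 γ + 2 γ_c ≤ 6 γ_t`
follows from `2 γ_c ≤ 3 γ_t`. The latter is obtained from a lower bound on `γ_t` and an explicit
connected dominating set.

*Lower bound.* Give each vertex a weight so that every open neighbourhood has weight at most `k`.
The open neighbourhoods of a total dominating set cover the graph, hence the total weight is at most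
`k γ_t` (`sum_le_mul_totalDominationNumber`). In `P_m □ P_n` the weights depend only on the position
in `P_m` (`mul_sum_le_mul_totalDominationNumber_pathGraph`): weights `1, 1, 1` and `k = 4` give
`3 n ≤ 4 γ_t` for `m = 3`, while weights `2, 1, 1, 2` and `k = 5` give `6 n ≤ 5 γ_t` for `m = 4`.

*Upper bound.* For `m = 3` the middle copy of `P_n` shows `γ_c ≤ n`. For `m = 4` the comb
`combSet`, a copy of `P_n` with teeth at every third vertex, shows
`γ_c ≤ n + ⌊(n + 2) / 3⌋ + ⌊(n + 1) / 3⌋`. For `m = n = 4` one needs that `6 n ≤ 5 γ_t` forces the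
integer `γ_t` to be at least `5`.
-/

namespace SimpleGraph

variable {V : Type*}

/-! ### Domination numbers of general graphs -/

theorem IsTotalDominatingSet.isDominatingSet {G : SimpleGraph V} {S : Finset V}
    (h : G.IsTotalDominatingSet S) : G.IsDominatingSet S :=
  fun v _ => h v

theorem exists_card_eq_totalDominationNumber [Fintype V] (G : SimpleGraph V)
    (h : ∀ v, ∃ w, G.Adj v w) :
    ∃ S : Finset V, G.IsTotalDominatingSet S ∧ S.card = G.totalDominationNumber := by
  obtain ⟨S, hS⟩ := G.exists_isTotalDominatingSet h
  exact Nat.sInf_mem (s := {k | ∃ S : Finset V, G.IsTotalDominatingSet S ∧ S.card = k})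
    ⟨_, S, hS, rfl⟩

theorem dominationNumber_le_totalDominationNumber [Fintype V] (G : SimpleGraph V)
    (h : ∀ v, ∃ w, G.Adj v w) : G.dominationNumber ≤ G.totalDominationNumber := by
  obtain ⟨S, hS, hc⟩ := G.exists_card_eq_totalDominationNumber h
  exact Nat.sInf_le ⟨S, hS.isDominatingSet, hc⟩

theorem IsConnectedDominatingSet.connectedDominationNumber_le {G : SimpleGraph V} {S : Finset V}
    (h : G.IsConnectedDominatingSet S) : G.connectedDominationNumber ≤ S.card :=
  Nat.sInf_le ⟨S, h, rfl⟩

/-- Weak duality for total domination: a weight function whose sum over each open neighbourhood is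
at most `k` has total weight at most `k` times the total domination number. -/
theorem sum_le_mul_totalDominationNumber [Fintype V] (G : SimpleGraph V)
    [DecidableRel G.Adj] (h : ∀ v, ∃ w, G.Adj v w) (w : V → ℕ) (k : ℕ)
    (hw : ∀ u, ∑ v ∈ G.neighborFinset u, w v ≤ k) :
    ∑ v, w v ≤ k * G.totalDominationNumber := by
  obtain ⟨S, hS, hc⟩ := G.exists_card_eq_totalDominationNumber h
  -- double counting: every `v` has a neighbour in `S`, so `w v` occurs in the right-hand sum
  calc ∑ v, w v ≤ ∑ v, ∑ u ∈ S with G.Adj u v, w v := by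
        refine Finset.sum_le_sum fun v _ => ?_
        obtain ⟨u, hu, huv⟩ := hS v
        exact Finset.single_le_sum (f := fun _ => w v) (fun _ _ => Nat.zero_le _)
          (Finset.mem_filter.2 ⟨hu, huv.symm⟩)
    _ = ∑ u ∈ S, ∑ v ∈ G.neighborFinset u, w v :=
        Finset.sum_comm' fun v u => by simp [and_comm]
    _ ≤ ∑ _u ∈ S, k := Finset.sum_le_sum fun u _ => hw u
    _ = k * G.totalDominationNumber := by rw [Finset.sum_const, hc, smul_eq_mul, mul_comm]

theorem ceil_le_totalDominationNumber [Fintype V] (G : SimpleGraph V)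
    (h : ∀ v, ∃ w, G.Adj v w)
    (hc : 2 * G.connectedDominationNumber ≤ 3 * G.totalDominationNumber) :
    ⌈(3 * (G.dominationNumber : ℚ) + 2 * (G.connectedDominationNumber : ℚ)) / 6⌉ ≤
      (G.totalDominationNumber : ℤ) := by
  have hd := G.dominationNumber_le_totalDominationNumber h
  have hc' : 2 * (G.connectedDominationNumber : ℚ) ≤ 3 * (G.totalDominationNumber : ℚ) := by
    exact_mod_cast hc
  have hd' : (G.dominationNumber : ℚ) ≤ G.totalDominationNumber := by exact_mod_cast hd
  rw [Int.ceil_le, Int.cast_natCast]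
  linarith

/-! ### Lower bound for the total domination number of grids -/

instance (n : ℕ) : DecidableRel (pathGraph n).Adj :=
  fun _ _ => decidable_of_iff' _ pathGraph_adj

theorem card_neighborFinset_pathGraph_le_two (n : ℕ) (j : Fin n) :
    ((pathGraph n).neighborFinset j).card ≤ 2 := by
  have hsub : ((pathGraph n).neighborFinset j).map Fin.valEmbedding ⊆
      {j.val - 1, j.val + 1} := by
    intro x hx
    simp only [Finset.mem_map, mem_neighborFinset, pathGraph_adj, Fin.valEmbedding_apply] at hx
    obtain ⟨y, hy, rfl⟩ := hx
    simp only [Finset.mem_insert, Finset.mem_singleton]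
    omega
  calc _ = _ := (Finset.card_map Fin.valEmbedding).symm
    _ ≤ _ := Finset.card_le_card hsub
    _ ≤ 2 := Finset.card_le_two

/-- In a grid with weights `w` constant along each copy of `P_n`, the neighbourhood of `(i, j)` has
weight at most that of the neighbourhood of `i` in `P_m` plus `2 * w i`. -/
theorem mul_sum_le_mul_totalDominationNumber_pathGraph (m n : ℕ)
    (h : ∀ v, ∃ u, (pathGraph m □ pathGraph n).Adj v u) (w : Fin m → ℕ) (k : ℕ)
    (hw : ∀ i, ∑ i' ∈ (pathGraph m).neighborFinset i, w i' + 2 * w i ≤ k) :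
    n * ∑ i, w i ≤ k * (pathGraph m □ pathGraph n).totalDominationNumber := by
  classical
  have key := (pathGraph m □ pathGraph n).sum_le_mul_totalDominationNumber h (fun v => w v.1) k
    (fun u => by
      rw [neighborFinset_boxProd, Finset.sum_disjUnion, Finset.sum_product, Finset.sum_product]
      simp only [Finset.sum_singleton, Finset.sum_const, smul_eq_mul,
        Finset.card_singleton, one_mul]
      have := Nat.mul_le_mul_right (w u.1) (card_neighborFinset_pathGraph_le_two n u.2)
      have := hw u.1
      omega)
  rw [Fintype.sum_prod_type] at key
  simpa [Finset.mul_sum] using key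

/-! ### Connected dominating sets of grids -/

theorem pathGraph_connected_of_pos {n : ℕ} (hn : 0 < n) : (pathGraph n).Connected := by
  obtain ⟨k, rfl⟩ := Nat.exists_eq_add_of_lt hn
  rw [zero_add]
  exact pathGraph_connected k

theorem grid_connected {m n : ℕ} (hm : 0 < m) (hn : 0 < n) :
    (pathGraph m □ pathGraph n).Connected :=
  (pathGraph_connected_of_pos hm).boxProd (pathGraph_connected_of_pos hn)

/-- A set containing a full copy of `H` in `G □ H` joins any two vertices of that copy. -/
theorem reachable_induce_boxProd {α β : Type*} {G : SimpleGraph α} {H : SimpleGraph β}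
    (hH : H.Connected) {S : Set (α × β)} {a : α} (hS : ∀ b, (a, b) ∈ S) (b b' : β) :
    ((G □ H).induce S).Reachable ⟨(a, b), hS b⟩ ⟨(a, b'), hS b'⟩ := by
  let f : H →g (G □ H).induce S :=
    ⟨fun b => ⟨(a, b), hS b⟩, fun {x y} hxy => by simpa [boxProd_adj] using hxy⟩
  exact (hH.preconnected b b').map f

theorem connectedDominationNumber_three_le {n : ℕ} (hn : 0 < n) :
    (pathGraph 3 □ pathGraph n).connectedDominationNumber ≤ n := by
  let S : Finset (Fin 3 × Fin n) := Finset.univ.image fun c => (1, c)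
  have hS : ∀ c : Fin n, ((1 : Fin 3), c) ∈ (S : Set (Fin 3 × Fin n)) := by simp [S]
  have hcard : S.card ≤ n := Finset.card_image_le.trans (by simp)
  refine le_trans (IsConnectedDominatingSet.connectedDominationNumber_le ⟨?_, ?_⟩) hcard
  · rintro ⟨i, c⟩ hv
    refine ⟨(1, c), hS c, boxProd_adj.2 (Or.inl ⟨?_, rfl⟩)⟩
    have hi : i ≠ 1 := fun h => hv (h ▸ hS c)
    rw [pathGraph_adj]
    fin_cases i <;> simp_all
  · refine (connected_iff_exists_forall_reachable _).2 ⟨⟨(1, ⟨0, hn⟩), hS _⟩, ?_⟩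
    rintro ⟨v, hv⟩
    obtain ⟨c, -, rfl⟩ := Finset.mem_image.1 (Finset.mem_coe.1 hv)
    exact reachable_induce_boxProd (pathGraph_connected_of_pos hn) hS _ _

/-- The comb in `P_4 □ P_n`, vertices of both paths being numbered from `0`: the copy of `P_n` at
height `1`, with a tooth reaching heights `2` and `3` at each position congruent to `1` modulo `3`.
When `n` is congruent to `1` modulo `3` the teeth miss the last position, and a tooth reaching only
height `2` is put there; this is the effect of the minimum. -/
def combSet (n : ℕ) (hn : 0 < n) : Finset (Fin 4 × Fin n) :=
  (Finset.univ.image fun c => (1, c)) ∪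
    (Finset.univ.image fun t : Fin ((n + 2) / 3) => (2, ⟨min (3 * t + 1) (n - 1), by omega⟩)) ∪
    Finset.univ.image fun t : Fin ((n + 1) / 3) => (3, ⟨3 * t + 1, by omega⟩)

theorem card_combSet_le (n : ℕ) (hn : 0 < n) :
    (combSet n hn).card ≤ n + (n + 2) / 3 + (n + 1) / 3 := by
  refine (Finset.card_union_le _ _).trans (add_le_add ((Finset.card_union_le _ _).trans
    (add_le_add ?_ ?_)) ?_) <;> exact Finset.card_image_le.trans (by simp)

theorem mem_combSet_one {n : ℕ} (hn : 0 < n) (c : Fin n) : (1, c) ∈ combSet n hn := by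
  simp [combSet]

theorem mem_combSet_two {n : ℕ} (hn : 0 < n) (c : Fin n) :
    (2, c) ∈ combSet n hn ↔ ∃ t, t < (n + 2) / 3 ∧ c.val = min (3 * t + 1) (n - 1) := by
  simp [combSet, Fin.ext_iff, Fin.exists_iff, eq_comm]

theorem mem_combSet_three {n : ℕ} (hn : 0 < n) (c : Fin n) :
    (3, c) ∈ combSet n hn ↔ ∃ t, t < (n + 1) / 3 ∧ c.val = 3 * t + 1 := by
  simp [combSet, Fin.ext_iff, Fin.exists_iff, eq_comm]

theorem zero_notMem_combSet {n : ℕ} (hn : 0 < n) (c : Fin n) : (0, c) ∉ combSet n hn := by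
  simp [combSet]

theorem isDominatingSet_combSet (n : ℕ) (hn : 0 < n) :
    (pathGraph 4 □ pathGraph n).IsDominatingSet (combSet n hn) := by
  rintro ⟨i, c⟩ hv
  have hvert : ∀ i' : Fin 4, (pathGraph 4).Adj i i' →
      (pathGraph 4 □ pathGraph n).Adj (i, c) (i', c) :=
    fun i' h => boxProd_adj.2 (Or.inl ⟨h, rfl⟩)
  fin_cases i
  · exact ⟨(1, c), mem_combSet_one hn c, hvert 1 (by simp [pathGraph_adj])⟩
  · exact absurd (mem_combSet_one hn c) hv
  · exact ⟨(1, c), mem_combSet_one hn c, hvert 1 (by simp [pathGraph_adj])⟩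
  · have hv' : ¬ ∃ t, t < (n + 1) / 3 ∧ c.val = 3 * t + 1 :=
      fun h => hv ((mem_combSet_three hn c).2 h)
    have hc := c.2
    by_cases hlast : c.val / 3 < (n + 1) / 3
    · -- the tooth at position `3 * (c / 3) + 1` is next to `c`
      have hne : c.val ≠ 3 * (c.val / 3) + 1 := fun h => hv' ⟨_, hlast, h⟩
      refine ⟨(3, ⟨3 * (c.val / 3) + 1, by omega⟩),
        (mem_combSet_three hn _).2 ⟨_, hlast, rfl⟩, boxProd_adj.2 (Or.inr ⟨?_, rfl⟩)⟩
      rw [pathGraph_adj]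
      dsimp only
      omega
    · -- here `n` is congruent to `1` modulo `3` and `c` is the last position
      exact ⟨(2, c), (mem_combSet_two hn c).2 ⟨c.val / 3, by omega, by omega⟩,
        hvert 2 (by simp [pathGraph_adj])⟩

theorem connected_induce_combSet (n : ℕ) (hn : 0 < n) :
    ((pathGraph 4 □ pathGraph n).induce (combSet n hn : Set (Fin 4 × Fin n))).Connected := by
  have h1 : ∀ c, (1, c) ∈ (combSet n hn : Set (Fin 4 × Fin n)) := mem_combSet_one hn
  have hrow := reachable_induce_boxProd (G := pathGraph 4) (pathGraph_connected_of_pos hn) h1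
    ⟨0, hn⟩
  have hstep : ∀ (i i' : Fin 4) (c : Fin n) (h : (i, c) ∈ (combSet n hn : Set (Fin 4 × Fin n)))
      (h' : (i', c) ∈ (combSet n hn : Set (Fin 4 × Fin n))), (pathGraph 4).Adj i i' →
      ((pathGraph 4 □ pathGraph n).induce (combSet n hn : Set (Fin 4 × Fin n))).Reachable
        ⟨(i, c), h⟩ ⟨(i', c), h'⟩ :=
    fun i i' c h h' hadj => Adj.reachable (boxProd_adj.2 (Or.inl ⟨hadj, rfl⟩))
  have hrow2 := fun c h2 => (hrow c).trans (hstep 1 2 c (h1 c) h2 (by simp [pathGraph_adj]))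
  refine (connected_iff_exists_forall_reachable _).2 ⟨⟨(1, ⟨0, hn⟩), h1 _⟩, ?_⟩
  rintro ⟨⟨i, c⟩, hv⟩
  fin_cases i
  · exact absurd hv (zero_notMem_combSet hn c)
  · exact hrow c
  · exact hrow2 c hv
  · obtain ⟨t, ht, hct⟩ := (mem_combSet_three hn c).1 hv
    have h2 : (2, c) ∈ combSet n hn :=
      (mem_combSet_two hn c).2 ⟨t, by omega, by have := c.2; omega⟩
    exact (hrow2 c h2).trans (hstep 2 3 c h2 hv (by simp [pathGraph_adj]))

theorem connectedDominationNumber_four_le {n : ℕ} (hn : 0 < n) :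
    (pathGraph 4 □ pathGraph n).connectedDominationNumber ≤ n + (n + 2) / 3 + (n + 1) / 3 :=
  (IsConnectedDominatingSet.connectedDominationNumber_le
    ⟨isDominatingSet_combSet n hn, connected_induce_combSet n hn⟩).trans (card_combSet_le n hn)

end SimpleGraph

/-! ### The inequality between the three domination numbers -/

theorem mainTheorem9 :
    (∀ n : ℕ, 3 ≤ n →
      (pathGraph 3 □ pathGraph n).Connected ∧
      (∀ v, ∃ w, (pathGraph 3 □ pathGraph n).Adj v w) ∧
      ⌈(3 * ((pathGraph 3 □ pathGraph n).dominationNumber : ℚ) +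
          2 * ((pathGraph 3 □ pathGraph n).connectedDominationNumber : ℚ)) / 6⌉ ≤
        ((pathGraph 3 □ pathGraph n).totalDominationNumber : ℤ)) ∧
    (∀ n : ℕ, 4 ≤ n →
      (pathGraph 4 □ pathGraph n).Connected ∧
      (∀ v, ∃ w, (pathGraph 4 □ pathGraph n).Adj v w) ∧
      ⌈(3 * ((pathGraph 4 □ pathGraph n).dominationNumber : ℚ) +
          2 * ((pathGraph 4 □ pathGraph n).connectedDominationNumber : ℚ)) / 6⌉ ≤
        ((pathGraph 4 □ pathGraph n).totalDominationNumber : ℤ)) := by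
  refine ⟨fun n hn => ?_, fun n hn => ?_⟩
  · have hconn := grid_connected (m := 3) (n := n) (by omega) (by omega)
    have : Nonempty (Fin n) := ⟨⟨0, by omega⟩⟩
    have hadj := hconn.preconnected.exists_adj_of_nontrivial
    refine ⟨hconn, hadj, ceil_le_totalDominationNumber _ hadj ?_⟩
    have ht := mul_sum_le_mul_totalDominationNumber_pathGraph 3 n hadj ![1, 1, 1] 4 (by decide)
    have hc := connectedDominationNumber_three_le (n := n) (by omega)
    have hsum : ∑ i, (![1, 1, 1] : Fin 3 → ℕ) i = 3 := by decide
    rw [hsum] at ht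
    omega
  · have hconn := grid_connected (m := 4) (n := n) (by omega) (by omega)
    have : Nonempty (Fin n) := ⟨⟨0, by omega⟩⟩
    have hadj := hconn.preconnected.exists_adj_of_nontrivial
    refine ⟨hconn, hadj, ceil_le_totalDominationNumber _ hadj ?_⟩
    -- `2, 1, 1, 2` solves `2 a + b = 5` and `a + 3 b = 5`: neighbourhoods away from the two end
    -- copies of `P_4` have weight exactly `5`
    have ht := mul_sum_le_mul_totalDominationNumber_pathGraph 4 n hadj ![2, 1, 1, 2] 5 (by decide)
    have hc := connectedDominationNumber_four_le (n := n) (by omega)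
    have hsum : ∑ i, (![2, 1, 1, 2] : Fin 4 → ℕ) i = 6 := by decide
    rw [hsum] at ht
    omega
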